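/- **Setting.** Let $\mathcal{G}_{n,m}$ be the space of pairs $(G,H)$, where $G$ is an undirected unweighted (simple) graph with vertices $v_1,\dots,v_n$ and $H=(h_1,\dots,h_n)$ assigns to each vertex a feature $h_i\in\mathbb{R}^m$, with the product of the discrete topology (on graphs) and the Euclidean topology (on features). Let $d(\cdot,\cdot)$ be the shortest-path distance in $G$ ($\infty$ between different components) and $\mathcal{N}_k(v_i)=\{v_j : d(v_i,v_j)\le k\}$. For $\sigma\in S_n$, $\sigma\ast(G,H)$ is $(G,H)$ with its vertices relabelled by $\sigma$. A function $\Phi:\mathcal{G}_{n,m}\to\mathbb{R}$ is permutation-invariant if $\Phi(\sigma\ast(G,H))=\Phi(G,H)$ for all $\sigma\in S_n$; a function $\Phi_v:\mathcal{G}_{n,m}\to\mathbb{R}^n$ is permutation-equivariant if $\Phi_v(\sigma\ast(G,H))=\sigma(\Phi_v(G,H))$ for all $\sigma\in S_n$. A *$k$-hop GNN* computes $h_i^{(0)}=f^{(0)}(h_i)$ and, for $l=1,\dots,L$, $$h_i^{(l)}=f^{(l)}\Big(h_i^{(l-1)},\sum_{v_j\in\mathcal{N}_k(v_i)}g^{(l)}\big(h_j^{(l-1)},d(v_i,v_j)\big)\Big),$$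 and then outputs either a real number $r\big(\sum_{i=1}^n h_i^{(L)}\big)$ (graph-level output) or the vector $\big(r(h_i^{(L)})\big)_{i=1}^n\in\mathbb{R}^n$ (vertex-level output). Here $L$ and the (Euclidean) dimensions of the intermediate features are arbitrary, and $f^{(l)},g^{(l)},r$ are arbitrary continuous functions. Let $\mathcal{F}'_k$ and $\mathcal{F}'_{k,v}$ be the sets of all such functions with graph-level and vertex-level output, respectively. The *$k$-hop Weisfeiler–Lehman test without hash collisions* colors the vertices by $C^{(0)}(v_i)=\mathrm{HASH}(h_i)$ and $$C^{(l)}(v_i)=\mathrm{HASH}\Big(C^{(l-1)}(v_i),\{\{(C^{(l-1)}(v_j),d(v_i,v_j)):v_j\in\mathcal{N}_k(v_i)\}\}\Big)$$ with injective $\mathrm{HASH}$; the coloring is stabilized once a further round no longer refines the partition of the vertices into color classes. The graph $(G,H)$ is *$k$-strongly separable* if in the stabilized coloring any two distinct vertices $v,w$ with $d(v,w)\le 2k$ have different colors. **Theorem.** Let $k\ge 2$ and let $\mathbb{P}$ be a Borel probability measure on $\mathcal{G}_{n,m}$. Suppose that, $\mathbb{P}$-almost surely, $(G,H)$ is $k$-strongly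 separable and $G$ is connected with no (simple) cycles of length greater than $2k-1$. Then the following hold. (i) For any $\epsilon,\delta>0$ and any permutation-invariant continuous function $\Phi:\mathcal{G}_{n,m}\to\mathbb{R}$, there exists $F\in\mathcal{F}'_k$ such that $$\mathbb{P}\big[\,|F(G,H)-\Phi(G,H)|>\delta\,\big]<\epsilon.$$ (ii) For any $\epsilon,\delta>0$ and any permutation-equivariant continuous function $\Phi_v:\mathcal{G}_{n,m}\to\mathbb{R}^n$, there exists $F_v\in\mathcal{F}'_{k,v}$ such that $$\mathbb{P}\big[\,\|F_v(G,H)-\Phi_v(G,H)\|>\delta\,\big]<\epsilon,$$ where $\|\cdot\|$ is the $\ell_2$-norm on $\mathbb{R}^n$. -/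

import Mathlib

open MeasureTheory

/-- The finite set of undirected (simple, unweighted) graphs on the vertex set `Fin n` carries the
discrete topology. -/
instance instTopologicalSpaceSimpleGraphFin (n : ℕ) : TopologicalSpace (SimpleGraph (Fin n)) := ⊥

instance instDiscreteTopologySimpleGraphFin (n : ℕ) : DiscreteTopology (SimpleGraph (Fin n)) := ⟨rfl⟩

/-- For this topology, the σ-algebra that Mathlib puts on the set of graphs is the Borel σ-algebra. -/
instance instBorelSpaceSimpleGraphFin (n : ℕ) : BorelSpace (SimpleGraph (Fin n)) := by
  constructor
  rw [borel_eq_top_of_discrete]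
  refine top_unique fun s _ => ?_
  have hsing : ∀ G : SimpleGraph (Fin n), MeasurableSet {G} := by
    intro G
    have h : ({G} : Set (SimpleGraph (Fin n))) = SimpleGraph.Adj ⁻¹' {G.Adj} := by
      ext G'
      exact SimpleGraph.adj_inj.symm
    rw [h]
    exact SimpleGraph.measurable_adj (Set.toFinite _).measurableSet
  rw [← Set.biUnion_of_singleton s]
  exact s.toFinite.measurableSet_biUnion fun G _ => hsing G

/-- The space of graphs `(G, H)` with `n` vertices, each carrying a feature in `ℝ^m`. The topology is
the product of the discrete topology (graphs) and the Euclidean topology (features). -/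
abbrev FeatureGraph (n m : ℕ) : Type :=
  SimpleGraph (Fin n) × (Fin n → EuclideanSpace ℝ (Fin m))

/-- The measurable structure on `FeatureGraph n m` is its Borel σ-algebra. -/
theorem borelSpace_featureGraph (n m : ℕ) : BorelSpace (FeatureGraph n m) := inferInstance

/-- The graph `σ ∗ (G, H)` in which the vertex `i` of `(G, H)` has been given the new label `σ i`. -/
def FeatureGraph.relabel {n m : ℕ} (σ : Equiv.Perm (Fin n)) (x : FeatureGraph n m) :
    FeatureGraph n m :=
  (x.1.comap σ.symm, fun i => x.2 (σ.symm i))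

/-- Permutation-invariant real functions on graphs. -/
def PermInvariant {n m : ℕ} (Φ : FeatureGraph n m → ℝ) : Prop :=
  ∀ (σ : Equiv.Perm (Fin n)) (x : FeatureGraph n m), Φ (x.relabel σ) = Φ x

/-- Permutation-equivariant functions with values in `ℝ^n`; here `σ` acts on `y ∈ ℝ^n` by
`(σ y)_{σ i} = y_i`. -/
def PermEquivariant {n m : ℕ} (Φ : FeatureGraph n m → EuclideanSpace ℝ (Fin n)) : Prop :=
  ∀ (σ : Equiv.Perm (Fin n)) (x : FeatureGraph n m) (i : Fin n), Φ (x.relabel σ) (σ i) = Φ x i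

open Classical in
/-- The `k`-hop neighbourhood of the vertex `i`: all vertices (`i` included) at shortest-path distance
at most `k` from `i`. The extended distance `edist` is infinite between different components. -/
noncomputable def khopNbhd {n : ℕ} (G : SimpleGraph (Fin n)) (k : ℕ) (i : Fin n) :
    Finset (Fin n) :=
  Finset.univ.filter fun j => G.edist i j ≤ (k : ℕ∞)

/-- The vertex-feature maps `(G, H) ↦ (h_i^{(L)})_i` that can be computed by an embedding layer
followed by finitely many aggregation layers of a `k`-hop GNN. All intermediate features are
in Euclidean spaces, the learnable functions `f`, `g` are arbitrary continuous functions, and the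
multiset of messages is aggregated by summation. The distance is an argument of `g` and ranges over
the discrete space `ℕ`. -/
inductive IsKHopFeature (k : ℕ) {n m : ℕ} :
    (d : ℕ) → (FeatureGraph n m → Fin n → EuclideanSpace ℝ (Fin d)) → Prop
  | embedding {d : ℕ} (f : EuclideanSpace ℝ (Fin m) → EuclideanSpace ℝ (Fin d))
      (hf : Continuous f) :
      IsKHopFeature k d (fun x i => f (x.2 i))
  | aggregation {d p d' : ℕ} (h : FeatureGraph n m → Fin n → EuclideanSpace ℝ (Fin d))
      (hh : IsKHopFeature k d h)
      (g : EuclideanSpace ℝ (Fin d) × ℕ → EuclideanSpace ℝ (Fin p)) (hg : Continuous g)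
      (f : EuclideanSpace ℝ (Fin d) × EuclideanSpace ℝ (Fin p) → EuclideanSpace ℝ (Fin d'))
      (hf : Continuous f) :
      IsKHopFeature k d' (fun x i =>
        f (h x i, ∑ j ∈ khopNbhd x.1 k i, g (h x j, x.1.dist i j)))

/-- All `k`-hop GNNs with graph-level output `r (∑ i, h_i^{(L)})`. -/
def KHopGNN (k n m : ℕ) : Set (FeatureGraph n m → ℝ) :=
  {F | ∃ (d : ℕ) (h : FeatureGraph n m → Fin n → EuclideanSpace ℝ (Fin d))
      (r : EuclideanSpace ℝ (Fin d) → ℝ),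
      IsKHopFeature k d h ∧ Continuous r ∧ F = fun x => r (∑ i, h x i)}

/-- All `k`-hop GNNs with vertex-level output `(r (h_i^{(L)}))_i`. -/
def KHopGNNVertex (k n m : ℕ) : Set (FeatureGraph n m → EuclideanSpace ℝ (Fin n)) :=
  {F | ∃ (d : ℕ) (h : FeatureGraph n m → Fin n → EuclideanSpace ℝ (Fin d))
      (r : EuclideanSpace ℝ (Fin d) → ℝ),
      IsKHopFeature k d h ∧ Continuous r ∧ F = fun x => WithLp.toLp 2 fun i => r (h x i)}

/-- The colors that occur in round `l` of the `k`-hop Weisfeiler-Lehman test without hash collisions: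
a color is (the injective name of) the data that were hashed, that is, an initial feature for `l = 0`,
and an old color with a multiset of pairs (color, distance) afterwards. -/
def WLColor (m : ℕ) : ℕ → Type
  | 0 => EuclideanSpace ℝ (Fin m)
  | l + 1 => WLColor m l × Multiset (WLColor m l × ℕ)

/-- The color of each vertex after `l` rounds of the collision-free `k`-hop Weisfeiler-Lehman test. -/
noncomputable def wlColor {n m : ℕ} (k : ℕ) (x : FeatureGraph n m) :
    (l : ℕ) → Fin n → WLColor m l
  | 0 => fun i => x.2 i
  | l + 1 => fun i => (wlColor k x l i,
      (khopNbhd x.1 k i).val.map fun j => (wlColor k x l j, x.1.dist i j))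

/-- The coloring is stabilized after `l` rounds: the next round does not refine the partition of the
vertices into color classes. -/
def WLStable {n m : ℕ} (k : ℕ) (x : FeatureGraph n m) (l : ℕ) : Prop :=
  ∀ i j : Fin n, wlColor k x l i = wlColor k x l j → wlColor k x (l + 1) i = wlColor k x (l + 1) j

/-- `(G, H)` is `k`-strongly separable: in the stabilized coloring of the collision-free `k`-hop
Weisfeiler-Lehman test, distinct vertices at distance at most `2 k` have different colors. (A stable
round exists, and all stable rounds give the same partition of the vertices.) -/
def StronglySeparable {n m : ℕ} (k : ℕ) (x : FeatureGraph n m) : Prop :=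
  ∃ l : ℕ, WLStable k x l ∧
    ∀ i j : Fin n, i ≠ j → x.1.edist i j ≤ ((2 * k : ℕ) : ℕ∞) →
      wlColor k x l i ≠ wlColor k x l j

/-- `G` has no (simple) cycle of length greater than `N`. -/
def NoCycleLongerThan {n : ℕ} (G : SimpleGraph (Fin n)) (N : ℕ) : Prop :=
  ∀ (v : Fin n) (c : G.Walk v v), c.IsCycle → c.length ≤ N

/-! Two well-behaved graphs that share a single stable colour are isomorphic. Equal colours let
edges be lifted from one graph to the other. A closed walk longer than `2 * k` is not a cycle, hence
splits into shorter closed walks; one of length at most `2 * k` has a closed lift by strong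
separability. So lifts of closed walks close up (`eq_of_walk`), and lifting from one matched pair of
vertices gives a global isomorphism (`exists_iso`, `exists_relabel_eq`). Consequently the colour of
a vertex determines the value of an equivariant function there.

Comparing colours across two graphs needs only `n * n` rounds, and sums of monomials of degree at
most `2 * n` determine multisets of size at most `n`. Hence some GNN feature is at least as fine as
the colours (`exists_isKHopFeature_wlColor`). On a compact set of well-behaved graphs the target
factors continuously through this feature, so the readout is exact there; inner regularity makes the
complement of such a set small. -/

/-! ### Lifting walks between two graphs -/

/-- The graph of simultaneous steps in `G` and `G'` between pairs of vertices related by `R`. -/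
def matchedPairs {V V' : Type*} (G : SimpleGraph V) (G' : SimpleGraph V') (R : V → V' → Prop) :
    SimpleGraph (V × V') where
  Adj p q := G.Adj p.1 q.1 ∧ G'.Adj p.2 q.2 ∧ R p.1 p.2 ∧ R q.1 q.2
  symm.symm _ _ h := ⟨h.1.symm, h.2.1.symm, h.2.2.2, h.2.2.1⟩
  loopless.irrefl _ h := G.loopless.irrefl _ h.1

namespace matchedPairs

variable {V V' : Type*} {G : SimpleGraph V} {G' : SimpleGraph V'} {R : V → V' → Prop}

/-- The first projection of simultaneous steps. -/
def fstHom : matchedPairs G G' R →g G := ⟨Prod.fst, fun h => h.1⟩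

/-- The second projection of simultaneous steps. -/
def sndHom : matchedPairs G G' R →g G' := ⟨Prod.snd, fun h => h.2.1⟩

/-- Exchanging the two coordinates. -/
def swapHom : matchedPairs G G' R →g matchedPairs G' G (fun a' a => R a a') :=
  ⟨Prod.swap, fun h => ⟨h.2.1, h.1, h.2.2⟩⟩

theorem rel_of_reachable {p q : V × V'} (h : (matchedPairs G G' R).Reachable p q)
    (hp : R p.1 p.2) : R q.1 q.2 := by
  obtain ⟨W⟩ := h
  induction W with
  | nil => exact hp
  | cons h _ ih => exact ih h.2.2.2

/-- If `G` has only short cycles and related vertices of `G'` are far apart, then the lift of a closed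
walk of `G` is closed. -/
theorem eq_of_walk {N : ℕ} (hN : 2 ≤ N)
    (hcyc : ∀ (v : V) (c : G.Walk v v), c.IsCycle → c.length ≤ N)
    (hsep : ∀ a a' b', R a a' → R a b' → G'.edist a' b' ≤ (N : ℕ∞) → a' = b') :
    ∀ (l : ℕ) (p q : V × V') (W : (matchedPairs G G' R).Walk p q),
      W.length = l → p.1 = q.1 → p = q := by
  intro l
  induction l using Nat.strong_induction_on with
  | _ l ih =>
  intro p q W hW hpq
  by_cases hl : l ≤ N
  · rcases Nat.eq_zero_or_pos l with h0 | h0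
    · exact W.eq_of_length_eq_zero (hW.trans h0)
    · have hR : R p.1 p.2 ∧ R q.1 q.2 := by
        cases W with
        | nil => simp only [SimpleGraph.Walk.length_nil] at hW; omega
        | cons h W' => exact ⟨h.2.2.1, rel_of_reachable ⟨W'⟩ h.2.2.2⟩
      refine Prod.ext hpq (hsep p.1 _ _ hR.1 (hpq ▸ hR.2) ?_)
      refine ((W.map sndHom).edist_le).trans ?_
      rw [SimpleGraph.Walk.length_map, hW]
      exact_mod_cast hl
  · obtain ⟨c, hcl, hcv⟩ : ∃ c : G.Walk p.1 p.1, c.length = l ∧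
        ∀ i, c.getVert i = (W.getVert i).1 := by
      obtain ⟨a, a'⟩ := p
      obtain ⟨b, b'⟩ := q
      obtain rfl : a = b := hpq
      exact ⟨W.map fstHom, (SimpleGraph.Walk.length_map ..).trans hW,
        fun i => SimpleGraph.Walk.getVert_map ..⟩
    -- Here `N < l` and `2 ≤ N`, so the length is at least 3, as a cycle requires.
    have hnc : ¬ c.tail.IsPath := fun h => by
      have := hcyc _ c (SimpleGraph.Walk.isCycle_iff_isPath_tail_and_le_length.mpr
        ⟨h, by omega⟩)
      omega
    obtain ⟨i, j, hij, hj, he⟩ : ∃ i j, i < j ∧ j < l ∧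
        (W.getVert (i + 1)).1 = (W.getVert (j + 1)).1 := by
      by_contra hcon
      push Not at hcon
      refine hnc (SimpleGraph.Walk.IsPath.getVert_injOn_iff _ |>.mp ?_)
      have htl : c.tail.length = l - 1 := by
        have := SimpleGraph.Walk.length_tail_add_one (p := c)
          (by rw [SimpleGraph.Walk.not_nil_iff_lt_length]; omega)
        omega
      intro i hi j hj he
      simp only [Set.mem_ofPred_eq, htl] at hi hj
      simp only [SimpleGraph.Walk.getVert_tail, hcv] at he
      rcases lt_trichotomy i j with h | h | h
      · exact absurd he (hcon i j h (by omega))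
      · exact h
      · exact absurd he.symm (hcon j i h (by omega))
    have hmid : W.getVert (i + 1) = W.getVert (j + 1) := by
      have hv : (W.drop (i + 1)).getVert (j - i) = W.getVert (j + 1) := by
        rw [SimpleGraph.Walk.drop_getVert]
        congr 1
        omega
      rw [← hv]
      refine ih _ ?_ _ _ ((W.drop (i + 1)).take (j - i)) rfl (by rw [hv]; exact he)
      rw [SimpleGraph.Walk.take_length]
      omega
    -- The inner loop closes in both coordinates, so it can be cut out, leaving a shorter walk from
    -- `p` to `q`.
    refine ih _ ?_ _ _ ((W.take (i + 1)).append ((W.drop (j + 1)).copy hmid.symm rfl)) rfl hpq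
    rw [SimpleGraph.Walk.length_append, SimpleGraph.Walk.length_copy,
      SimpleGraph.Walk.take_length, SimpleGraph.Walk.drop_length]
    omega

/-- Lifting walks of the connected graph `G`. -/
theorem exists_reachable (hG : G.Connected)
    (hlift : ∀ a a' b, R a a' → G.Adj a b → ∃ b', G'.Adj a' b' ∧ R b b')
    {v : V} {v' : V'} (hv : R v v') (u : V) :
    ∃ u', (matchedPairs G G' R).Reachable (v, v') (u, u') := by
  obtain ⟨W⟩ := hG.preconnected v u
  induction W generalizing v' with
  | nil => exact ⟨v', .rfl⟩
  | cons h _ ih =>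
    obtain ⟨b', hb', hR⟩ := hlift _ _ _ hv h
    obtain ⟨u', hu'⟩ := ih hR
    refine ⟨u', SimpleGraph.Reachable.trans (SimpleGraph.Adj.reachable ?_) hu'⟩
    exact ⟨h, hb', hv, hR⟩

/-- The edge lifts to some neighbour `c'` of `a'`; both `(b, b')` and `(b, c')` lie in the component
of `(v, v')`, so closedness of lifts forces `c' = b'`. -/
theorem adj_of_reachable {N : ℕ} (hN : 2 ≤ N)
    (hcyc : ∀ (v : V) (c : G.Walk v v), c.IsCycle → c.length ≤ N)
    (hsep : ∀ a a' b', R a a' → R a b' → G'.edist a' b' ≤ (N : ℕ∞) → a' = b')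
    (hlift : ∀ a a' b, R a a' → G.Adj a b → ∃ b', G'.Adj a' b' ∧ R b b')
    {v a b : V} {v' a' b' : V'} (hv : R v v')
    (ha : (matchedPairs G G' R).Reachable (v, v') (a, a'))
    (hb : (matchedPairs G G' R).Reachable (v, v') (b, b')) (h : G.Adj a b) : G'.Adj a' b' := by
  have hRa := rel_of_reachable ha hv
  obtain ⟨c', hc', hR⟩ := hlift _ _ _ hRa h
  have hstep : (matchedPairs G G' R).Adj (a, a') (b, c') := ⟨h, hc', hRa, hR⟩
  obtain ⟨W⟩ := hb.symm.trans (ha.trans hstep.reachable)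
  have := eq_of_walk hN hcyc hsep _ _ _ W rfl rfl
  rw [Prod.mk.injEq] at this
  exact this.2 ▸ hc'

/-- Two connected graphs with only short cycles, whose vertices are related by a relation that lifts
edges in both directions and separates nearby vertices, are isomorphic. -/
theorem exists_iso {N : ℕ} (hN : 2 ≤ N) (hG : G.Connected) (hG' : G'.Connected)
    (hcyc : ∀ (v : V) (c : G.Walk v v), c.IsCycle → c.length ≤ N)
    (hcyc' : ∀ (v : V') (c : G'.Walk v v), c.IsCycle → c.length ≤ N)
    (hsep : ∀ a a' b', R a a' → R a b' → G'.edist a' b' ≤ (N : ℕ∞) → a' = b')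
    (hsep' : ∀ a' a b, R a a' → R b a' → G.edist a b ≤ (N : ℕ∞) → a = b)
    (hlift : ∀ a a' b, R a a' → G.Adj a b → ∃ b', G'.Adj a' b' ∧ R b b')
    (hlift' : ∀ a' a b', R a a' → G'.Adj a' b' → ∃ b, G.Adj a b ∧ R b b')
    {v : V} {v' : V'} (hv : R v v') :
    ∃ σ : G ≃g G', σ v = v' ∧ ∀ u, R u (σ u) := by
  -- The component of `(v, v')` turns out to be the graph of the bijection: lifting in each
  -- direction gives existence, `eq_of_walk` uniqueness.
  choose f hf using exists_reachable hG hlift hv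
  choose g hg using exists_reachable (R := fun a' a => R a a') hG' hlift' hv
  replace hg : ∀ u', (matchedPairs G G' R).Reachable (v, v') (g u', u') := fun u' =>
    (hg u').map swapHom
  have huniq : ∀ u a' b', (matchedPairs G G' R).Reachable (v, v') (u, a') →
      (matchedPairs G G' R).Reachable (v, v') (u, b') → a' = b' := fun u a' b' ha hb => by
    obtain ⟨W⟩ := ha.symm.trans hb
    exact congrArg Prod.snd (eq_of_walk hN hcyc hsep _ _ _ W rfl rfl)
  have huniq' : ∀ u' a b, (matchedPairs G G' R).Reachable (v, v') (a, u') →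
      (matchedPairs G G' R).Reachable (v, v') (b, u') → a = b := fun u' a b ha hb => by
    obtain ⟨W⟩ := (ha.symm.trans hb).map swapHom
    exact congrArg Prod.snd (eq_of_walk hN hcyc' hsep' _ _ _ W rfl rfl)
  refine ⟨⟨⟨f, g, fun u => huniq' _ _ _ (hg (f u)) (hf u),
    fun u' => huniq _ _ _ (hf (g u')) (hg u')⟩, fun {a b} => ⟨fun h => ?_, fun h => ?_⟩⟩,
    huniq _ _ _ (hf v) .rfl, fun u => rel_of_reachable (hf u) hv⟩
  · exact adj_of_reachable (G := G') (G' := G) (R := fun a' a => R a a') hN hcyc' hsep' hlift' hv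
      ((hf a).map swapHom) ((hf b).map swapHom) h
  · exact adj_of_reachable hN hcyc hsep hlift hv (hf a) (hf b) h

end matchedPairs

/-! ### Stabilization of colours across two graphs -/

section WeisfeilerLehman

variable {n m k : ℕ}

/-- The pairs of vertices that have different colors after `l` rounds. -/
def wlDistinguished (k : ℕ) (x y : FeatureGraph n m) (l : ℕ) : Set (Fin n × Fin n) :=
  {p | wlColor k x l p.1 ≠ wlColor k y l p.2}

theorem wlColor_eq_of_succ {x y : FeatureGraph n m} {l : ℕ} {u u' : Fin n}
    (h : wlColor k x (l + 1) u = wlColor k y (l + 1) u') : wlColor k x l u = wlColor k y l u' :=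
  congrArg Prod.fst h

theorem wlColor_succ_rel {x y : FeatureGraph n m} {l : ℕ} {u u' : Fin n}
    (h : wlColor k x (l + 1) u = wlColor k y (l + 1) u') :
    Multiset.Rel (fun w w' => wlColor k x l w = wlColor k y l w' ∧
      x.1.dist u w = y.1.dist u' w') (khopNbhd x.1 k u).val (khopNbhd y.1 k u').val := by
  have h2 : (khopNbhd x.1 k u).val.map (fun j => (wlColor k x l j, x.1.dist u j)) =
      (khopNbhd y.1 k u').val.map (fun j => (wlColor k y l j, y.1.dist u' j)) :=
    congrArg Prod.snd h
  rw [← Multiset.rel_eq, Multiset.rel_map] at h2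
  exact h2.mono fun a _ b _ hab => ⟨congrArg Prod.fst hab, congrArg Prod.snd hab⟩

theorem monotone_wlDistinguished (x y : FeatureGraph n m) : Monotone (wlDistinguished k x y) :=
  monotone_nat_of_le_succ fun _ _ hp h => hp (wlColor_eq_of_succ h)

/-- A refinement depends on the old colours only through which pairs agree, so one idle round makes
the next idle too. -/
theorem wlDistinguished_succ_eq {x y : FeatureGraph n m} {l : ℕ}
    (h : wlDistinguished k x y l = wlDistinguished k x y (l + 1)) :
    wlDistinguished k x y (l + 1) = wlDistinguished k x y (l + 2) := by
  refine Set.Subset.antisymm (monotone_wlDistinguished x y (Nat.le_succ _)) ?_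
  rintro ⟨u, u'⟩ hp heq
  refine hp (Prod.ext heq ?_)
  change (khopNbhd x.1 k u).val.map (fun j => (wlColor k x (l + 1) j, x.1.dist u j)) =
    (khopNbhd y.1 k u').val.map (fun j => (wlColor k y (l + 1) j, y.1.dist u' j))
  rw [← Multiset.rel_eq, Multiset.rel_map]
  refine (wlColor_succ_rel heq).mono fun w _ w' _ hw => Prod.ext ?_ hw.2
  have : (w, w') ∉ wlDistinguished k x y l := fun hn => hn hw.1
  rw [h] at this
  exact not_not.mp this

theorem wlDistinguished_eq {x y : FeatureGraph n m} {l : ℕ} (hl : n * n ≤ l) :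
    wlDistinguished k x y l = wlDistinguished k x y (n * n) := by
  have hmono := monotone_wlDistinguished (k := k) x y
  have hcard : ∀ a b, a ≤ b →
      (wlDistinguished k x y a).ncard = (wlDistinguished k x y b).ncard →
      wlDistinguished k x y a = wlDistinguished k x y b := fun a b hab h =>
    Set.eq_of_subset_of_ncard_le (hmono hab) h.ge (Set.toFinite _)
  -- Cardinalities are bounded by `n * n` and grow strictly until the first idle round.
  refine (hcard _ _ hl (Eq.symm ?_)).symm
  refine Nat.stabilises_of_monotone (f := fun l => (wlDistinguished k x y l).ncard)
    (fun a b hab => Set.ncard_le_ncard (hmono hab) (Set.toFinite _)) (fun a => ?_)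
    (fun a h => congrArg Set.ncard (wlDistinguished_succ_eq (hcard _ _ (Nat.le_succ _) h))) hl
  refine (Set.ncard_le_ncard (Set.subset_univ _) (Set.toFinite _)).trans ?_
  simp [Set.ncard_univ]

/-- Vertices with the same color after `n²` rounds have the same color after any number of rounds. -/
theorem wlColor_eq_of_eq {x y : FeatureGraph n m} {u u' : Fin n}
    (h : wlColor k x (n * n) u = wlColor k y (n * n) u') (l : ℕ) :
    wlColor k x l u = wlColor k y l u' := by
  by_contra hne
  have hmem : (u, u') ∈ wlDistinguished k x y (max l (n * n)) :=
    monotone_wlDistinguished x y (le_max_left _ _) hne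
  rw [wlDistinguished_eq (le_max_right _ _)] at hmem
  exact hmem h

theorem StronglySeparable.eq_of_wlColor_eq {x : FeatureGraph n m} (hx : StronglySeparable k x)
    {u w : Fin n} (h : wlColor k x (n * n) u = wlColor k x (n * n) w)
    (hd : x.1.edist u w ≤ ((2 * k : ℕ) : ℕ∞)) : u = w := by
  obtain ⟨l, -, hl⟩ := hx
  by_contra hne
  exact hl u w hne hd (wlColor_eq_of_eq h l)

theorem exists_adj_wlColor_eq (hk : 1 ≤ k) {x y : FeatureGraph n m} {u u' w : Fin n}
    (h : wlColor k x (n * n) u = wlColor k y (n * n) u') (hw : x.1.Adj u w) :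
    ∃ w', y.1.Adj u' w' ∧ wlColor k x (n * n) w = wlColor k y (n * n) w' := by
  have hmem : w ∈ (khopNbhd x.1 k u).val := by
    simp only [khopNbhd, Finset.mem_val, Finset.mem_filter, Finset.mem_univ, true_and]
    rw [SimpleGraph.edist_eq_one_iff_adj.mpr hw]
    exact_mod_cast hk
  -- One extra round exposes the neighbours' colours after `n * n` rounds; distance 1 identifies
  -- adjacency.
  obtain ⟨w', -, hc, hd⟩ :=
    Multiset.exists_mem_of_rel_of_mem (wlColor_succ_rel (wlColor_eq_of_eq h (n * n + 1))) hmem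
  rw [SimpleGraph.dist_eq_one_iff_adj.mpr hw] at hd
  exact ⟨w', SimpleGraph.dist_eq_one_iff_adj.mp hd.symm, hc⟩

end WeisfeilerLehman

/-- Well-behaved graphs with vertices of the same color differ by a relabelling that matches these
vertices. -/
theorem exists_relabel_eq {n m k : ℕ} (hk : 1 ≤ k) {x y : FeatureGraph n m}
    (hx : StronglySeparable k x ∧ x.1.Connected ∧ NoCycleLongerThan x.1 (2 * k - 1))
    (hy : StronglySeparable k y ∧ y.1.Connected ∧ NoCycleLongerThan y.1 (2 * k - 1))
    {v v' : Fin n} (hv : wlColor k x (n * n) v = wlColor k y (n * n) v') :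
    ∃ σ : Equiv.Perm (Fin n), x.relabel σ = y ∧ σ v = v' := by
  obtain ⟨σ, hσ, hR⟩ := matchedPairs.exists_iso (N := 2 * k)
    (R := fun u u' => wlColor k x (n * n) u = wlColor k y (n * n) u')
    (by omega) hx.2.1 hy.2.1 (fun v c hc => (hx.2.2 v c hc).trans (by omega))
    (fun v c hc => (hy.2.2 v c hc).trans (by omega))
    (fun a a' b' ha hb hd => hy.1.eq_of_wlColor_eq (ha.symm.trans hb) hd)
    (fun a' a b ha hb hd => hx.1.eq_of_wlColor_eq (ha.trans hb.symm) hd)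
    (fun a a' b ha hab => exists_adj_wlColor_eq hk ha hab)
    (fun a' a b' ha hab => by
      obtain ⟨b, hb, hc⟩ := exists_adj_wlColor_eq hk ha.symm hab
      exact ⟨b, hb, hc.symm⟩) hv
  refine ⟨σ.toEquiv, Prod.ext ?_ ?_, hσ⟩
  · ext a b
    change x.1.Adj (σ.symm a) (σ.symm b) ↔ y.1.Adj a b
    rw [← σ.map_adj_iff, σ.apply_symm_apply, σ.apply_symm_apply]
  · funext a
    have h0 : x.2 (σ.symm a) = y.2 (σ (σ.symm a)) := wlColor_eq_of_eq (hR (σ.symm a)) 0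
    rw [σ.apply_symm_apply] at h0
    exact h0

/-! ### Encoding multisets by sums of monomials -/

section MultisetEncoding

variable {X κ ι : Type*} [Fintype κ]

/-- All products, indexed by `κ`, of coordinates of a point or constants `1`. -/
def monomials (φ : X → ι → ℝ) (κ : Type*) [Fintype κ] (x : X) (s : κ → Option ι) : ℝ :=
  ∏ j, (s j).elim 1 (φ x)

theorem continuous_monomials [TopologicalSpace X] {φ : X → ι → ℝ} (hφ : Continuous φ) :
    Continuous (monomials φ κ) := by
  refine continuous_pi fun s => continuous_finsetProd _ fun j _ => ?_
  cases s j with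
  | none => exact continuous_const
  | some i => exact (continuous_apply i).comp hφ

/-- There is a combination of monomials that vanishes at all but one of finitely many points. -/
theorem exists_sum_monomials_separating [DecidableEq κ] [Fintype ι] {φ : X → ι → ℝ}
    (hφ : Function.Injective φ)
    (q : κ → X) (p : X) :
    ∃ B : (κ → Option ι) → ℝ, (∑ s, B s * monomials φ κ p s ≠ 0) ∧
      ∀ j, q j ≠ p → ∑ s, B s * monomials φ κ (q j) s = 0 := by
  classical
  -- An affine form for each `j`: nonzero at `p`, and zero at `q j` unless `q j = p`, where the
  -- constant 1 is taken. The product of these forms expands into monomials.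
  have hA : ∀ j, ∃ A : Option ι → ℝ, (∑ i, A i * i.elim 1 (φ p) ≠ 0) ∧
      (q j ≠ p → ∑ i, A i * i.elim 1 (φ (q j)) = 0) := by
    intro j
    by_cases hj : q j = p
    · exact ⟨fun i => i.elim 1 fun _ => 0, by simp [Fintype.sum_option], fun h => absurd hj h⟩
    · obtain ⟨i, hi⟩ := Function.ne_iff.mp (hφ.ne hj)
      refine ⟨fun o => o.elim (-φ (q j) i) (Pi.single i 1), ?_, fun _ => ?_⟩
      · simp only [Fintype.sum_option, Option.elim_none, Option.elim_some, mul_one]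
        rw [Finset.sum_eq_single i (fun b _ hb => by simp [hb]) (by simp)]
        simp only [Pi.single_eq_same, one_mul]
        intro h
        exact hi (by linarith)
      · simp only [Fintype.sum_option, Option.elim_none, Option.elim_some, mul_one]
        rw [Finset.sum_eq_single i (fun b _ hb => by simp [hb]) (by simp)]
        simp
  choose A hA1 hA2 using hA
  have hprod : ∀ x, ∑ s : κ → Option ι, (∏ j, A j (s j)) * monomials φ κ x s =
      ∏ j, ∑ i, A j i * i.elim 1 (φ x) := by
    intro x
    rw [Finset.prod_univ_sum, Fintype.piFinset_univ]
    simp only [monomials, Finset.prod_mul_distrib]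
  refine ⟨fun s => ∏ j, A j (s j), ?_, fun j hj => ?_⟩
  · rw [hprod]
    exact Finset.prod_ne_zero_iff.mpr fun j _ => hA1 j
  · rw [hprod]
    exact Finset.prod_eq_zero (Finset.mem_univ j) (hA2 j hj)

/-- The sums of the monomials of sufficiently high degree determine a multiset. -/
theorem map_eq_map_of_sum_monomials_eq [Finite ι] {φ : X → ι → ℝ} (hφ : Function.Injective φ)
    {a b : κ → X} {s t : Finset κ}
    (h : ∑ j ∈ s, monomials φ (κ ⊕ κ) (a j) = ∑ j ∈ t, monomials φ (κ ⊕ κ) (b j)) :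
    s.val.map a = t.val.map b := by
  classical
  have := Fintype.ofFinite ι
  ext p
  -- The points of both families other than `p` are killed, so summing `ψ` over a multiset reads off
  -- the multiplicity of `p`; this is why the degree is indexed by `κ ⊕ κ`.
  obtain ⟨B, hB, hB0⟩ := exists_sum_monomials_separating hφ (Sum.elim a b) p
  set ψ : X → ℝ := fun x => ∑ i, B i * monomials φ (κ ⊕ κ) x i with hψ
  have hcount : ∀ (c : κ → X) (r : Finset κ), (∀ j, c j ≠ p → ψ (c j) = 0) →
      ∑ j ∈ r, ψ (c j) = (r.val.map c).count p * ψ p := by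
    intro c r hc
    rw [Multiset.count_map, ← Finset.filter_val, Finset.card_val, ← nsmul_eq_mul,
      ← Finset.sum_const, Finset.sum_filter]
    refine Finset.sum_congr rfl fun j _ => ?_
    split_ifs with hj
    · rw [hj]
    · exact hc j (Ne.symm hj)
  have hsum : ∀ (c : κ → X) (r : Finset κ),
      ∑ j ∈ r, ψ (c j) = ∑ i, B i * (∑ j ∈ r, monomials φ (κ ⊕ κ) (c j)) i := by
    intro c r
    simp only [hψ, Finset.sum_apply, Finset.mul_sum]
    exact Finset.sum_comm
  have key : ((s.val.map a).count p : ℝ) * ψ p = (t.val.map b).count p * ψ p := by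
    rw [← hcount a s fun j hj => hB0 (Sum.inl j) hj, ← hcount b t fun j hj => hB0 (Sum.inr j) hj,
      hsum, hsum, h]
  exact_mod_cast mul_right_cancel₀ hB key

end MultisetEncoding

/-! ### GNN features as fine as the colours -/

section Features

variable {n m k : ℕ}

/-- The coordinates of a message: those of the feature and the distance. -/
def messageCoord {d : ℕ} (z : EuclideanSpace ℝ (Fin d) × ℕ) (i : Option (Fin d)) : ℝ :=
  i.elim (z.2 : ℝ) z.1

theorem messageCoord_injective {d : ℕ} : Function.Injective (messageCoord (d := d)) := by
  rintro ⟨z, a⟩ ⟨w, b⟩ h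
  refine Prod.ext ?_ ?_
  · ext i
    exact congrFun h (some i)
  · exact Nat.cast_injective (R := ℝ) (congrFun h none)

theorem continuous_messageCoord {d : ℕ} : Continuous (messageCoord (d := d)) := by
  refine continuous_pi fun i => ?_
  cases i with
  | none => exact (continuous_of_discreteTopology (f := fun a : ℕ => (a : ℝ))).comp continuous_snd
  | some i => exact (EuclideanSpace.proj (𝕜 := ℝ) i).continuous.comp continuous_fst

/-- Some `k`-hop GNN feature distinguishes all vertices that the first `l` rounds of the
`k`-hop Weisfeiler-Lehman test distinguish. -/
theorem exists_isKHopFeature_wlColor (k n m l : ℕ) :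
    ∃ (d : ℕ) (h : FeatureGraph n m → Fin n → EuclideanSpace ℝ (Fin d)), IsKHopFeature k d h ∧
      ∀ x y i j, h x i = h y j → wlColor k x l i = wlColor k y l j := by
  induction l with
  | zero => exact ⟨m, _, .embedding id continuous_id, fun x y i j h => h⟩
  | succ l ih =>
    obtain ⟨d, h, hh, hinj⟩ := ih
    -- Linear isomorphisms give the Euclidean types a layer demands; linearity lets `e` be pulled
    -- out of the sum.
    let e := toEuclidean (E := (Fin n ⊕ Fin n → Option (Option (Fin d))) → ℝ)
    let e' := toEuclidean (E := EuclideanSpace ℝ (Fin d) × EuclideanSpace ℝ (Fin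
      (Module.finrank ℝ ((Fin n ⊕ Fin n → Option (Option (Fin d))) → ℝ))))
    refine ⟨_, _, .aggregation h hh (fun z => e (monomials messageCoord (Fin n ⊕ Fin n) z))
      (e.continuous.comp (continuous_monomials continuous_messageCoord)) e' e'.continuous, ?_⟩
    intro x y i j hxy
    have hpair := e'.injective hxy
    rw [Prod.mk.injEq] at hpair
    obtain ⟨h1, h2⟩ := hpair
    rw [← map_sum, ← map_sum] at h2
    have h3 := map_eq_map_of_sum_monomials_eq
      (a := fun w => (h x w, x.1.dist i w)) (b := fun w => (h y w, y.1.dist j w))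
      messageCoord_injective (e.injective h2)
    rw [← Multiset.rel_eq, Multiset.rel_map] at h3
    refine Prod.ext (hinj _ _ _ _ h1) ?_
    change (khopNbhd x.1 k i).val.map (fun w => (wlColor k x l w, x.1.dist i w)) =
      (khopNbhd y.1 k j).val.map (fun w => (wlColor k y l w, y.1.dist j w))
    rw [← Multiset.rel_eq, Multiset.rel_map]
    refine h3.mono fun w _ w' _ hw => ?_
    rw [Prod.mk.injEq] at hw
    exact Prod.ext (hinj _ _ _ _ hw.1) hw.2

theorem IsKHopFeature.continuous {d : ℕ}
    {h : FeatureGraph n m → Fin n → EuclideanSpace ℝ (Fin d)} (hh : IsKHopFeature k d h)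
    (i : Fin n) : Continuous fun x => h x i := by
  induction hh generalizing i with
  | embedding f hf => exact hf.comp ((continuous_apply i).comp continuous_snd)
  | aggregation h _ g hg f hf ih =>
    -- For a fixed graph the neighbourhoods and distances are constants.
    refine continuous_prod_of_discrete_left.mpr fun G => ?_
    have hG : ∀ j, Continuous fun H => h (G, H) j := fun j =>
      (ih j).comp (Continuous.prodMk_right G)
    have hsum : Continuous fun H => ∑ j ∈ khopNbhd G k i, g (h (G, H) j, G.dist i j) :=
      continuous_finsetSum _ fun j _ => hg.comp ((hG j).prodMk continuous_const)
    exact hf.comp ((hG i).prodMk hsum)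

end Features

/-! ### Exact computation on compact sets and approximation -/

/-- A continuous real function on a compact space that is constant on the fibres of a continuous map
factors continuously through this map, with a factor defined on the whole target. -/
theorem exists_continuous_comp_eq {Y E : Type*} [TopologicalSpace Y] [CompactSpace Y]
    [TopologicalSpace E] [T4Space E] {f : Y → E} (hf : Continuous f) {Φ : Y → ℝ}
    (hΦ : Continuous Φ) (h : ∀ a b, f a = f b → Φ a = Φ b) :
    ∃ r : E → ℝ, Continuous r ∧ ∀ a, r (f a) = Φ a := by
  let f' : C(Y, Set.range f) := ⟨Set.rangeFactorization f, hf.rangeFactorization⟩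
  -- A continuous surjection from a compact space to a Hausdorff one is closed, hence a quotient
  -- map; Tietze then extends the factor from the closed range.
  have hq : Topology.IsQuotientMap f' := f'.continuous.isClosedMap.isQuotientMap f'.continuous
    Set.rangeFactorization_surjective
  have hfac : Function.FactorsThrough (⟨Φ, hΦ⟩ : C(Y, ℝ)) f' := fun a b hab =>
    h a b (congrArg Subtype.val hab)
  obtain ⟨r, hr⟩ := ContinuousMap.exists_restrict_eq (isCompact_range hf).isClosed
    (hq.lift ⟨Φ, hΦ⟩ hfac)
  refine ⟨r, r.continuous, fun a => ?_⟩
  have h1 := DFunLike.congr_fun hr (f' a)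
  have h2 := DFunLike.congr_fun (hq.lift_comp ⟨Φ, hΦ⟩ hfac) a
  exact h1.trans h2

section Approximation

variable {n m k : ℕ}

/-- On a compact set of well-behaved graphs, a permutation-equivariant function is computed exactly
by a `k`-hop GNN with vertex-level output. -/
theorem exists_isKHopFeature_eq_on_compact (hk : 1 ≤ k) {K : Set (FeatureGraph n m)}
    (hK : IsCompact K)
    (hgood : ∀ x ∈ K, StronglySeparable k x ∧ x.1.Connected ∧ NoCycleLongerThan x.1 (2 * k - 1))
    {Φ : FeatureGraph n m → EuclideanSpace ℝ (Fin n)} (hΦ : Continuous Φ)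
    (hequi : PermEquivariant Φ) :
    ∃ (d : ℕ) (h : FeatureGraph n m → Fin n → EuclideanSpace ℝ (Fin d))
      (r : EuclideanSpace ℝ (Fin d) → ℝ), IsKHopFeature k d h ∧ Continuous r ∧
      ∀ x ∈ K, ∀ i, r (h x i) = Φ x i := by
  obtain ⟨d, h, hh, hinj⟩ := exists_isKHopFeature_wlColor k n m (n * n)
  have := isCompact_iff_compactSpace.mp hK
  have hcont : ∀ {E : Type} [TopologicalSpace E] (f : FeatureGraph n m → Fin n → E),
      (∀ i, Continuous fun x => f x i) → Continuous fun a : K × Fin n => f a.1 a.2 :=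
    fun f hf => continuous_prod_of_discrete_right.mpr fun i => (hf i).comp continuous_subtype_val
  -- Working on `K × Fin n` gives one readout for all vertices: equal features at `(x, i)` and `(y,
  -- j)` yield a relabelling of `x` to `y` with `i ↦ j`.
  obtain ⟨r, hr, hrΦ⟩ := exists_continuous_comp_eq (hcont h hh.continuous)
    (hcont (fun x i => Φ x i) fun i => (EuclideanSpace.proj (𝕜 := ℝ) i).continuous.comp hΦ)
    (by
      rintro ⟨⟨x, hx⟩, i⟩ ⟨⟨y, hy⟩, j⟩ hxy
      obtain ⟨σ, rfl, rfl⟩ := exists_relabel_eq hk (hgood x hx) (hgood y hy) (hinj _ _ _ _ hxy)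
      exact (hequi σ x i).symm)
  exact ⟨d, h, r, hh, hr, fun x hx i => hrΦ (⟨x, hx⟩, i)⟩

end Approximation

theorem mainTheorem5 (n m k : ℕ) (hk : 2 ≤ k)
    (P : Measure (FeatureGraph n m)) [IsProbabilityMeasure P]
    (hP : ∀ᵐ x ∂P, StronglySeparable k x ∧ x.1.Connected ∧ NoCycleLongerThan x.1 (2 * k - 1)) :
    (∀ ε δ : ℝ, 0 < ε → 0 < δ →
      ∀ Φ : FeatureGraph n m → ℝ, Continuous Φ → PermInvariant Φ →
        ∃ F ∈ KHopGNN k n m,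
          P {x | δ < |F x - Φ x|} < ENNReal.ofReal ε) ∧
    (∀ ε δ : ℝ, 0 < ε → 0 < δ →
      ∀ Φ : FeatureGraph n m → EuclideanSpace ℝ (Fin n), Continuous Φ → PermEquivariant Φ →
        ∃ F ∈ KHopGNNVertex k n m,
          P {x | δ < ‖F x - Φ x‖} < ENNReal.ofReal ε) := by
  have hcompact : ∀ ε : ℝ, 0 < ε → ∃ K : Set (FeatureGraph n m), IsCompact K ∧
      (∀ x ∈ K, StronglySeparable k x ∧ x.1.Connected ∧ NoCycleLongerThan x.1 (2 * k - 1)) ∧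
      P Kᶜ < ENNReal.ofReal ε := by
    intro ε hε
    obtain ⟨t, ht, htm, ht0⟩ := exists_measurable_superset_of_null (ae_iff.mp hP)
    obtain ⟨K, hKt, hK, hPK⟩ := htm.compl.exists_isCompact_lt_add (measure_ne_top P _)
      (ENNReal.ofReal_pos.mpr hε).ne'
    refine ⟨K, hK, fun x hx => ?_, ?_⟩
    · by_contra hbad
      exact hKt hx (ht hbad)
    · rw [(prob_compl_eq_one_iff htm).mpr ht0] at hPK
      rw [prob_compl_eq_one_sub hK.measurableSet]
      exact ENNReal.sub_lt_of_lt_add prob_le_one (by rwa [add_comm])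
  refine ⟨fun ε δ hε hδ Φ hΦ hinv => ?_, fun ε δ hε hδ Φ hΦ hequi => ?_⟩
  · obtain ⟨K, hK, hgood, hPK⟩ := hcompact ε hε
    -- The invariant `Φ` is treated as an equivariant function with equal entries. A further layer
    -- with zero-dimensional messages applies `r` at each vertex, so the sum is `n * Φ x` on `K` and
    -- the readout divides by `n`.
    obtain ⟨d, h, r, hh, hr, hrΦ⟩ := exists_isKHopFeature_eq_on_compact (by omega) hK hgood
      (Φ := fun x => WithLp.toLp 2 fun _ => Φ x)
      ((PiLp.continuous_toLp 2 _).comp (continuous_pi fun _ => hΦ)) (fun σ x _ => hinv σ x)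
    let f : EuclideanSpace ℝ (Fin d) × EuclideanSpace ℝ (Fin 0) → EuclideanSpace ℝ (Fin 1) :=
      fun z => WithLp.toLp 2 fun _ => r z.1
    have hf : Continuous f := (PiLp.continuous_toLp 2 _).comp
      (continuous_pi fun _ => hr.comp continuous_fst)
    refine ⟨_, ⟨1, _, fun z => z 0 / n, .aggregation h hh (fun _ => 0) continuous_const f hf,
      ((EuclideanSpace.proj (𝕜 := ℝ) (0 : Fin 1)).continuous).div_const _, rfl⟩,
      (measure_mono fun x hx hxK => ?_).trans_lt hPK⟩
    have hn : (n : ℝ) ≠ 0 := by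
      obtain ⟨i⟩ := (hgood x hxK).2.1.nonempty
      exact_mod_cast i.pos.ne'
    have hsum : ∑ i, r (h x i) = n * Φ x := by
      rw [Finset.sum_congr rfl fun i _ => hrΦ x hxK i]
      simp
    refine not_lt.mpr hδ.le (lt_of_lt_of_eq hx ?_)
    simp [f, hsum, hn]
  · obtain ⟨K, hK, hgood, hPK⟩ := hcompact ε hε
    obtain ⟨d, h, r, hh, hr, hrΦ⟩ := exists_isKHopFeature_eq_on_compact (by omega) hK hgood hΦ hequi
    refine ⟨_, ⟨d, h, r, hh, hr, rfl⟩, (measure_mono fun x hx hxK => ?_).trans_lt hPK⟩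
    have hxΦ : (WithLp.toLp 2 fun i => r (h x i)) = Φ x := by
      ext i
      exact hrΦ x hxK i
    refine not_lt.mpr hδ.le (lt_of_lt_of_eq hx ?_)
    simp [hxΦ]
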